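/- Let $M$ be a smooth manifold (Hausdorff, second countable) and let $\mathcal TM$ be an extended tangent bundle (exact Courant algebroid) over $M$: a vector bundle with a Loday bracket $*$ on its sections, a non-degenerate symmetric pairing $\langle\,,\rangle$ and an anchor $a:\mathcal TM\to TM$ such that, for all sections, $$\mathfrak X*(\mathfrak Y*\mathfrak Z)=(\mathfrak X*\mathfrak Y)*\mathfrak Z+\mathfrak Y*(\mathfrak X*\mathfrak Z),\qquad a(\mathfrak X)\langle\mathfrak Y,\mathfrak Z\rangle=\langle\mathfrak X,\mathfrak Y*\mathfrak Z+\mathfrak Z*\mathfrak Y\rangle=\langle\mathfrak X*\mathfrak Y,\mathfrak Z\rangle+\langle\mathfrak Y,\mathfrak X*\mathfrak Z\rangle ,$$ which fits into an exact sequence $0\to T^*M\xrightarrow{a^*}\mathcal TM\xrightarrow{a}TM\to0$ with $\xi(a(\mathfrak X))=2\langle a^*\xi,\mathfrak X\rangle$. Forms $\xi\in\Omega^1(M)$ are regarded as sections of $\mathcal TM$ via $a^*$. An isotropic splitting $s:TM\to\mathcal TM$ determines the closed $3$-form $H(X,Y,Z)=2\langle s(X),s(Y)*s(Z)\rangle$;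 the $2$-forms act on the set $\mathcal I(M)$ of isotropic splittings by $(B\circ s)(X)=s(X)+\iota_XB$. The space of spinors $\mathcal S^\bullet(M)=\mathcal I(M)\times_{\Omega^2(M)}\Omega^\bullet(M)$ consists of the families $(\rho_s)_{s\in\mathcal I(M)}$ of differential forms with $\rho_{B\circ s}=e^B\wedge\rho_s$; it is $\mathbb Z/2$-graded, and carries the following operators, given in a splitting $s$, with $\mathfrak X=s(X)+\xi$, by $$d_{\mathcal T}\rho=d\rho-H\wedge\rho,\qquad \iota_{\mathfrak X}\rho=\iota_X\rho+\xi\wedge\rho,\qquad \mathcal L^{\mathcal T}_{\mathfrak X}\rho=\mathcal L_X\rho+(d\xi-\iota_XH)\wedge\rho .$$ Let $\mathfrak g$ be a finite-dimensional real Lie algebra and let $\delta:\mathfrak g\to\Gamma(\mathcal TM)$ be a linear map which defines an isotropic extended action: $\langle\delta(\tau),\delta(\upsilon)\rangle=0$ for all $\tau,\upsilon\in\mathfrak g$, and $\kappa\circ\delta$ is a homomorphism of Lie algebras, where, in a splitting, $\kappa(s(X)+\xi)=(X,d\xi-\iota_XH)\in\Gamma(TM)\oplus\Omega^2(M)$,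 the latter with the bracket $[(X,P),(Y,Q)]=([X,Y],\mathcal L_XQ-\mathcal L_YP)$. The extended equivariant Cartan complex $C^\bullet_{\mathfrak g}(\mathcal TM;\delta)$ is the $\mathbb Z/2$-graded space of formal power series $\rho$ on $\mathfrak g$ with values in $\mathcal S^\bullet(M)$ such that $\mathcal L^{\mathcal T}_{\delta(\tau)}\rho(\tau)=0$ for all $\tau\in\mathfrak g$, with the odd differential $(d_{\mathcal T,\delta}\rho)(\tau)=d_{\mathcal T}\rho(\tau)-\iota_{\delta(\tau)}\rho(\tau)$. Its cohomology is denoted $H^\bullet_G(\mathcal TM;\delta)$. Let $f:\mathfrak g\to C^\infty(M)$, $\tau\mapsto f_\tau$, be a $\mathfrak g$-equivariant linear map, i.e. $f_{[\tau,\upsilon]}=X_\tau(f_\upsilon)$ with $X_\tau=a(\delta(\tau))$, and put $\delta_f(\tau)=\delta(\tau)+df_\tau$. Then: 1. $\delta_f$ again defines an isotropic extended action, and $\kappa\circ\delta_f=\kappa\circ\delta$. 2. Let $b(\tau)=f_\tau$, that is, $b=\sum_ju_jf_{\tau_j}$ for dual bases $(\tau_j)$ of $\mathfrak g$ and $(u_j)$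 of $\mathfrak g^*$. Multiplication by $e^b$ (the equivariant $B$-transform) is a bijection from $C^i_{\mathfrak g}(\mathcal TM;\delta)$ onto $C^i_{\mathfrak g}(\mathcal TM;\delta_f)$ for $i\in\mathbb Z/2$, and $d_{\mathcal T,\delta_f}(e^b\rho)=e^b\,d_{\mathcal T,\delta}\rho$ for all $\rho\in C^\bullet_{\mathfrak g}(\mathcal TM;\delta)$. 3. Consequently the map $[\rho]\mapsto[e^b\rho]$ is an isomorphism of real vector spaces $H^i_G(\mathcal TM;\delta)\cong H^i_G(\mathcal TM;\delta_f)$ for each $i\in\mathbb Z/2$. -/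

import Mathlib

open scoped Manifold ContDiff

namespace ExtendedCartan

noncomputable section

/-! ### Differential forms

Everything is built over the algebra `A = C^∞(M)` of smooth functions on a manifold `M`. -/

/-- Smooth vector fields `Γ(TM)`, as derivations of the algebra `A = C^∞(M)`; the Lie bracket is the
commutator of derivations. -/
abbrev VF (A : Type*) [CommRing A] [Algebra ℝ A] := Derivation ℝ A A

/-- Differential `k`-forms `Ω^k(M)`: alternating `C^∞(M)`-multilinear forms in `k` vector
fields. -/
abbrev Form (A : Type*) [CommRing A] [Algebra ℝ A] (k : ℕ) := VF A [⋀^Fin k]→ₗ[A] A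

section Forms

variable {A : Type*} [CommRing A] [Algebra ℝ A]

theorem update_bracket_add {k : ℕ} (α : Form A k) {i j : Fin k} (hij : i ≠ j)
    {v : Fin k → VF A} (hv : v i = v j) (w : VF A) :
    α (Function.update v i w) + α (Function.update v j w) = 0 := by
  have h := α.map_swap (Function.update v i w) hij
  have e : Function.update v i w ∘ Equiv.swap i j = Function.update v j w := by
    funext l
    by_cases hl : l = i
    · subst hl; simp [hij, hij.symm, hv]
    · by_cases hl' : l = j
      · subst hl'; simp
      · simp [Equiv.swap_apply_of_ne_of_ne hl hl', hl, hl']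
  rw [e] at h
  rw [h, add_neg_cancel]

/-- The Lie derivative of a `k`-form along a vector field:
`(L_X α)(Y₁, …, Y_k) = X(α(Y₁, …, Y_k)) - ∑ⱼ α(Y₁, …, [X, Yⱼ], …, Y_k)`. -/
def lieDeriv {k : ℕ} (X : VF A) (α : Form A k) : Form A k where
  toFun v := X (α v) - ∑ j, α (Function.update v j ⁅X, v j⁆)
  map_update_add' := by
    intro inst v i x y
    obtain rfl : inst = instDecidableEqFin k := Subsingleton.elim _ _
    have hj : ∀ j, α (Function.update (Function.update v i (x + y)) j
          ⁅X, Function.update v i (x + y) j⁆) =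
        α (Function.update (Function.update v i x) j ⁅X, Function.update v i x j⁆) +
        α (Function.update (Function.update v i y) j ⁅X, Function.update v i y j⁆) := by
      intro j
      by_cases h : j = i
      · subst h; simp [lie_add]
      · simp only [Function.update_of_ne h]
        rw [Function.update_comm (Ne.symm h), Function.update_comm (Ne.symm h),
          Function.update_comm (Ne.symm h)]
        simp
    simp only [hj, AlternatingMap.map_update_add, map_add, Finset.sum_add_distrib]
    ring
  map_update_smul' := by
    intro inst v i c x
    obtain rfl : inst = instDecidableEqFin k := Subsingleton.elim _ _
    have hj : ∀ j, α (Function.update (Function.update v i (c • x)) j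
          ⁅X, Function.update v i (c • x) j⁆) =
        c * α (Function.update (Function.update v i x) j ⁅X, Function.update v i x j⁆) +
        if j = i then X c * α (Function.update v i x) else 0 := by
      intro j
      by_cases h : j = i
      · subst h
        simp [LieRinehartRing.leibniz_smul_right]
      · simp only [Function.update_of_ne h, if_neg h, add_zero]
        rw [Function.update_comm (Ne.symm h), Function.update_comm (Ne.symm h)]
        simp
    simp only [hj, AlternatingMap.map_update_smul, smul_eq_mul, Derivation.leibniz,
      Finset.sum_add_distrib, Finset.sum_ite_eq', Finset.mem_univ, if_true, ← Finset.mul_sum]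
    ring
  map_eq_zero_of_eq' := by
    intro v i j hv hij
    rw [α.map_eq_zero_of_eq v hv hij, map_zero, zero_sub, neg_eq_zero,
      Fintype.sum_eq_add i j hij]
    · rw [hv]; exact update_bracket_add α hij hv _
    · rintro l ⟨hi, hj⟩
      refine α.map_eq_zero_of_eq _ (i := i) (j := j) ?_ hij
      simp [hi.symm, hj.symm, hv]

theorem lieDeriv_apply {k : ℕ} (X : VF A) (α : Form A k) (v : Fin k → VF A) :
    lieDeriv X α v = X (α v) - ∑ j, α (Function.update v j ⁅X, v j⁆) := rfl

/-- Forget from `A`-multilinear to `ℝ`-multilinear. -/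
def Form.toReal {k : ℕ} (α : Form A k) : VF A [⋀^Fin k]→ₗ[ℝ] A where
  __ := α.toMultilinearMap.restrictScalars ℝ
  map_eq_zero_of_eq' v _ _ hv hij := α.map_eq_zero_of_eq v hv hij

@[simp] theorem Form.toReal_apply {k : ℕ} (α : Form A k) (v : Fin k → VF A) :
    Form.toReal α v = α v := rfl

/-- The exterior derivative as an `ℝ`-multilinear alternating map. -/
def dAux {k : ℕ} (α : Form A k) : VF A [⋀^Fin (k + 1)]→ₗ[ℝ] A :=
  (1 / 2 : ℝ) • AlternatingMap.alternatizeUncurryFin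
    { toFun := fun X => X.toLinearMap.compAlternatingMap (Form.toReal α)
        + Form.toReal (lieDeriv X α)
      map_add' := fun X Y => by
        ext v
        simp [lieDeriv_apply, add_lie, Finset.sum_add_distrib]
        ring
      map_smul' := fun c X => by
        ext v
        have h : ∀ (j : Fin k) (W : VF A), α (Function.update v j (c • W)) =
            c • α (Function.update v j W) := fun j W => by
          rw [← algebraMap_smul A c W, α.map_update_smul, algebraMap_smul]
        simp [lieDeriv_apply, smul_lie, Finset.smul_sum, smul_sub, h]
         }

theorem dAux_apply {k : ℕ} (α : Form A k) (v : Fin (k + 1) → VF A) :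
    dAux α v = (1 / 2 : ℝ) • ∑ i : Fin (k + 1), (-1) ^ (i : ℕ) •
      (v i (α (i.removeNth v)) + lieDeriv (v i) α (i.removeNth v)) := by
  simp [dAux, AlternatingMap.alternatizeUncurryFin_apply]

theorem lieDeriv_smul {k : ℕ} (c : A) (X : VF A) (α : Form A k) (v : Fin k → VF A) :
    lieDeriv (c • X) α v = c * lieDeriv X α v + ∑ j, v j c * α (Function.update v j X) := by
  have hl : ∀ Y : VF A, ⁅c • X, Y⁆ = c • ⁅X, Y⁆ - Y c • X := by
    intro Y
    rw [← lie_skew, LieRinehartRing.leibniz_smul_right, ← lie_skew Y X, smul_neg]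
    have hY : ⁅Y, c⁆ = Y c := rfl
    rw [hY]
    abel
  simp only [lieDeriv_apply, hl, AlternatingMap.map_update_sub, AlternatingMap.map_update_smul,
    smul_eq_mul, Finset.sum_sub_distrib, ← Finset.mul_sum]
  simp
  ring

theorem dAux_smul_zero {k : ℕ} (α : Form A k) (c : A) (X : VF A) (v : Fin k → VF A) :
    dAux α (Matrix.vecCons (c • X) v) = c * dAux α (Matrix.vecCons X v) := by
  have key : ∀ j : Fin k, (-1 : ℤ) ^ ((j.succ : Fin (k + 1)) : ℕ) •
      (v j (α (j.succ.removeNth (Matrix.vecCons (c • X) v)))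
        + lieDeriv (v j) α (j.succ.removeNth (Matrix.vecCons (c • X) v))) =
      c * ((-1 : ℤ) ^ ((j.succ : Fin (k + 1)) : ℕ) •
        (v j (α (j.succ.removeNth (Matrix.vecCons X v)))
          + lieDeriv (v j) α (j.succ.removeNth (Matrix.vecCons X v))))
        - v j c * α (Function.update v j X) := by
    intro j
    obtain ⟨m, rfl⟩ : ∃ m, k = m + 1 := ⟨k - 1, by have := j.pos; omega⟩
    have hr : ∀ W : VF A, j.succ.removeNth (Matrix.vecCons W v) =
        Matrix.vecCons W (j.removeNth v) := by
      intro W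
      funext l
      refine Fin.cases ?_ (fun l => ?_) l <;> simp [Fin.removeNth, Matrix.vecCons]
    have hs : ∀ β : Form A (m + 1), β (Matrix.vecCons (c • X) (j.removeNth v)) =
        c * β (Matrix.vecCons X (j.removeNth v)) := by
      intro β
      simpa using β.map_vecCons_smul (j.removeNth v) c X
    have hu : α (Function.update v j X) =
        (-1 : ℤ) ^ (j : ℕ) • α (Matrix.vecCons X (j.removeNth v)) := by
      rw [← AlternatingMap.map_insertNth]; simp
    rw [hr, hr, hs, hs, hu]
    simp only [Derivation.leibniz, smul_eq_mul, Fin.val_succ, zsmul_eq_mul, pow_succ]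
    push_cast
    ring
  have h0 : ∀ W : VF A, (0 : Fin (k + 1)).removeNth (Matrix.vecCons W v) = v := by
    intro W; funext l; simp [Fin.removeNth, Matrix.vecCons]
  simp only [dAux_apply, Fin.sum_univ_succ, Matrix.cons_val_succ, key, h0]
  simp only [Matrix.cons_val_zero, lieDeriv_smul, Finset.sum_sub_distrib, ← Finset.mul_sum,
    Fin.val_zero, pow_zero, one_smul, Derivation.smul_apply, smul_eq_mul]
  rw [mul_smul_comm]
  congr 1
  ring

theorem dAux_smul {k : ℕ} (α : Form A k) (v : Fin (k + 1) → VF A) (i : Fin (k + 1)) (c : A)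
    (X : VF A) :
    dAux α (Function.update v i (c • X)) = c * dAux α (Function.update v i X) := by
  have h : ∀ W : VF A, dAux α (Function.update v i W) =
      (-1 : ℤ) ^ (i : ℕ) • dAux α (Matrix.vecCons W (i.removeNth v)) := by
    intro W
    rw [← AlternatingMap.map_insertNth]; simp
  rw [h, h, dAux_smul_zero, mul_smul_comm]

/-- The exterior derivative. The formula
`dα(v₀, …, v_k) = 1/2 ∑ᵢ (-1)^i (vᵢ(α(…, v̂ᵢ, …)) + (L_{vᵢ} α)(…, v̂ᵢ, …))`
is the usual invariant formula with its two sums put together: see `extDeriv_apply_koszul` (and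
`extDeriv_zero_apply` for functions). -/
def extDeriv {k : ℕ} (α : Form A k) : Form A (k + 1) where
  toFun v := (1 / 2 : ℝ) • ∑ i : Fin (k + 1), (-1) ^ (i : ℕ) •
      (v i (α (i.removeNth v)) + lieDeriv (v i) α (i.removeNth v))
  map_update_add' := by
    intro inst v i x y
    obtain rfl : inst = instDecidableEqFin (k + 1) := Subsingleton.elim _ _
    simp only [← dAux_apply]
    exact (dAux α).map_update_add v i x y
  map_update_smul' := by
    intro inst v i c x
    obtain rfl : inst = instDecidableEqFin (k + 1) := Subsingleton.elim _ _
    simp only [← dAux_apply]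
    exact dAux_smul α v i c x
  map_eq_zero_of_eq' := by
    intro v i j hv hij
    simp only [← dAux_apply]
    exact (dAux α).map_eq_zero_of_eq v hv hij

theorem extDeriv_apply {k : ℕ} (α : Form A k) (v : Fin (k + 1) → VF A) :
    extDeriv α v = (1 / 2 : ℝ) • ∑ i : Fin (k + 1), (-1) ^ (i : ℕ) •
      (v i (α (i.removeNth v)) + lieDeriv (v i) α (i.removeNth v)) := rfl

/-- The invariant (Koszul) formula for the exterior derivative. The pair of indices `(i, j)` of the
double sum stands for the pair `(i, j + 1)` of the usual notation. -/
theorem extDeriv_apply_koszul {k : ℕ} (α : Form A (k + 1)) (v : Fin (k + 2) → VF A) :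
    extDeriv α v = ∑ i : Fin (k + 2), (-1) ^ (i : ℕ) • v i (α (i.removeNth v)) -
      ∑ i : Fin (k + 1), ∑ j ≥ i, (-1) ^ (i + j : ℕ) •
        α (Matrix.vecCons ⁅v i.castSucc, v j.succ⁆ (j.removeNth (i.castSucc.removeNth v))) := by
  have hT : ∑ i : Fin (k + 2), ∑ j : Fin (k + 1), (-1 : ℤ) ^ (i : ℕ) •
      α (Function.update (i.removeNth v) j ⁅v i, i.removeNth v j⁆) =
      (2 : ℤ) • ∑ i : Fin (k + 1), ∑ j ≥ i, (-1 : ℤ) ^ (i + j : ℕ) •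
        α (Matrix.vecCons ⁅v i.castSucc, v j.succ⁆ (j.removeNth (i.castSucc.removeNth v))) := by
    rw [Fin.sum_sum_eq_sum_triangle_add, Finset.smul_sum]
    refine Fintype.sum_congr _ _ fun i => ?_
    rw [Finset.smul_sum]
    refine Finset.sum_congr rfl fun j hj => ?_
    rw [Finset.mem_Ici] at hj
    simp only [← Fin.insertNth_removeNth, AlternatingMap.map_insertNth]
    rw [Fin.removeNth_removeNth_eq_swap]
    have H₁ : i.castSucc.succAbove j = j.succ := by simp [Fin.succAbove_of_le_castSucc, hj]
    have H₂ : j.predAbove i.castSucc = i := by simp [Fin.predAbove_of_le_castSucc, hj]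
    have H₃ : j.succ.succAbove i = i.castSucc := by simp [Fin.succAbove_of_castSucc_lt, hj]
    have hn : ∀ (X Y : VF A) (w : Fin k → VF A), α (Matrix.vecCons ⁅Y, X⁆ w) =
        - α (Matrix.vecCons ⁅X, Y⁆ w) := by
      intro X Y w
      rw [← lie_skew, ← neg_one_smul A, α.map_vecCons_smul, neg_one_smul]
    simp only [Fin.removeNth_apply, H₁, H₂, H₃]
    rw [hn (v i.castSucc) (v j.succ)]
    simp only [Fin.val_castSucc, Fin.val_succ, zsmul_eq_mul, pow_add]
    push_cast
    ring
  have h2 : ∀ x : A, (1 / 2 : ℝ) • ((2 : ℤ) • x) = x := by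
    intro x
    rw [← Int.cast_smul_eq_zsmul ℝ, smul_smul]; norm_num
  have hS : ∑ i : Fin (k + 2), (-1 : ℤ) ^ (i : ℕ) •
      (v i (α (i.removeNth v)) + lieDeriv (v i) α (i.removeNth v)) =
      (2 : ℤ) • (∑ i : Fin (k + 2), (-1 : ℤ) ^ (i : ℕ) • v i (α (i.removeNth v)) -
      ∑ i : Fin (k + 1), ∑ j ≥ i, (-1 : ℤ) ^ (i + j : ℕ) •
        α (Matrix.vecCons ⁅v i.castSucc, v j.succ⁆
          (j.removeNth (i.castSucc.removeNth v)))) := by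
    rw [smul_sub, ← hT, Finset.smul_sum, ← Finset.sum_sub_distrib]
    refine Fintype.sum_congr _ _ fun i => ?_
    rw [lieDeriv_apply, ← Finset.smul_sum, smul_add, smul_sub, two_smul]
    abel
  rw [extDeriv_apply, hS, h2]


/-- On functions, `df(X) = X(f)`. -/
theorem extDeriv_zero_apply (f : A) (X : VF A) :
    extDeriv (AlternatingMap.constOfIsEmpty A (VF A) (Fin 0) f : Form A 0) ![X] = X f := by
  rw [extDeriv_apply]
  simp only [Fin.sum_univ_succ, lieDeriv_apply]
  simp
  rw [← two_smul ℝ, smul_smul]; norm_num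

theorem lieDeriv_add {k : ℕ} (X : VF A) (α β : Form A k) :
    lieDeriv X (α + β) = lieDeriv X α + lieDeriv X β := by
  ext v
  simp [lieDeriv_apply, Finset.sum_add_distrib]
  ring

theorem lieDeriv_const_smul {k : ℕ} (X : VF A) (c : ℝ) (α : Form A k) :
    lieDeriv X (c • α) = c • lieDeriv X α := by
  ext v
  simp [lieDeriv_apply, Finset.smul_sum, smul_sub]

theorem extDeriv_add {k : ℕ} (α β : Form A k) :
    extDeriv (α + β) = extDeriv α + extDeriv β := by
  ext v
  simp only [extDeriv_apply, lieDeriv_add, AlternatingMap.add_apply, map_add, smul_add,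
    Finset.sum_add_distrib]
  abel

theorem extDeriv_const_smul {k : ℕ} (c : ℝ) (α : Form A k) :
    extDeriv (c • α) = c • extDeriv α := by
  ext v
  simp only [extDeriv_apply, lieDeriv_const_smul, AlternatingMap.smul_apply, Derivation.map_smul,
    ← smul_add, smul_comm _ c, ← Finset.smul_sum]

/-- The exterior product of a `p`-form and a `q`-form (`h : p + q = k`): the sum over
`(p, q)`-shuffles `σ` of `sign σ * α (v_{σ 1}, …, v_{σ p}) * β (v_{σ (p+1)}, …, v_{σ k})`. -/
def wedge {p q k : ℕ} (h : p + q = k) (α : Form A p) (β : Form A q) : Form A k :=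
  ((LinearMap.mul' A A).compAlternatingMap (α.domCoprod β)).domDomCongr
    (finSumFinEquiv.trans (finCongr h))

theorem wedge_add {p q k : ℕ} (h : p + q = k) (α : Form A p) (β γ : Form A q) :
    wedge h α (β + γ) = wedge h α β + wedge h α γ := by
  simp only [wedge, ← AlternatingMap.domCoprod'_apply, TensorProduct.tmul_add, map_add,
    LinearMap.compAlternatingMap_add, AlternatingMap.domDomCongr_add]

theorem wedge_smul {p q k : ℕ} (h : p + q = k) (α : Form A p) (c : A) (β : Form A q) :
    wedge h α (c • β) = c • wedge h α β := by
  simp only [wedge, ← AlternatingMap.domCoprod'_apply, TensorProduct.tmul_smul, map_smul,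
    LinearMap.compAlternatingMap_smul, AlternatingMap.domDomCongr_smul]

end Forms

section Total

/-- The space `Ω^•(M)` of differential forms, given by their components `ρ k` in `Ω^k(M)` (which
vanishes for `k > dim M`). -/
abbrev Forms (A : Type*) [CommRing A] [Algebra ℝ A] := (k : ℕ) → Form A k

variable {A : Type*} [CommRing A] [Algebra ℝ A]

instance Form.instIsScalarTower (k : ℕ) : IsScalarTower ℝ A (Form A k) :=
  ⟨fun c a α => by ext v; simp⟩

/-- A function, as a `0`-form. -/
def ofFun (f : A) : Form A 0 := AlternatingMap.constOfIsEmpty A (VF A) (Fin 0) f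

theorem ofFun_add (f g : A) : ofFun (f + g) = ofFun f + ofFun g := rfl

theorem ofFun_smul (c : ℝ) (f : A) : ofFun (c • f) = c • ofFun f := rfl

/-- The exterior derivative on `Ω^•(M)`. -/
def Forms.d : Forms A →ₗ[ℝ] Forms A where
  toFun ρ
    | 0 => 0
    | k + 1 => extDeriv (ρ k)
  map_add' ρ σ := by
    funext k
    cases k with
    | zero => simp
    | succ k => simp [extDeriv_add]
  map_smul' c ρ := by
    funext k
    cases k with
    | zero => simp
    | succ k => simp [extDeriv_const_smul]

/-- The contraction `ι_X` on `Ω^•(M)`: `(ι_X ρ)(Y₁, …) = ρ(X, Y₁, …)`. -/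
def Forms.contract (X : VF A) : Forms A →ₗ[ℝ] Forms A where
  toFun ρ k := (ρ (k + 1)).curryLeft X
  map_add' ρ σ := by funext k; simp
  map_smul' c ρ := by funext k; ext v; simp

/-- The Lie derivative `L_X` on `Ω^•(M)`. -/
def Forms.lie (X : VF A) : Forms A →ₗ[ℝ] Forms A where
  toFun ρ k := lieDeriv X (ρ k)
  map_add' ρ σ := by funext k; simp [lieDeriv_add]
  map_smul' c ρ := by funext k; simp [lieDeriv_const_smul]

/-- Left exterior multiplication `α ∧ ·` by a `p`-form on `Ω^•(M)`. -/
def Forms.wedgeLeft {p : ℕ} (α : Form A p) : Forms A →ₗ[A] Forms A where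
  toFun ρ k := if h : p ≤ k then wedge (Nat.add_sub_cancel' h) α (ρ (k - p)) else 0
  map_add' ρ σ := by
    funext k
    by_cases h : p ≤ k <;> simp [h, wedge_add]
  map_smul' c ρ := by
    funext k
    by_cases h : p ≤ k <;> simp [h, wedge_smul]

/-- The action of `e^B`: `e^B ∧ ρ = ∑ⱼ (1/j!) B ∧ ⋯ ∧ B ∧ ρ` for a `2`-form `B`; in each degree `k` only the terms with
`2 j ≤ k` contribute. -/
def Forms.expWedge (B : Form A 2) (ρ : Forms A) : Forms A := fun k =>
  ∑ j ∈ Finset.range (k + 1), ((Nat.factorial j : ℝ)⁻¹) • ((Forms.wedgeLeft B ^ j) ρ) k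

end Total

/-! ### Courant algebroids -/

/-- A Courant algebroid on a vector bundle over `M` with `C^∞(M)`-module of sections `Γ`. Bundle maps
are given by the corresponding `C^∞(M)`-linear maps of sections; non-degeneracy of the pairing says
that it identifies `Γ` with its `C^∞(M)`-dual. `bracket x y` is the Loday (Dorfman) bracket
`x * y`. -/
structure CourantAlgebroid (A Γ : Type*) [CommRing A] [Algebra ℝ A] [AddCommGroup Γ]
    [Module ℝ Γ] [Module A Γ] where
  bracket : Γ →ₗ[ℝ] Γ →ₗ[ℝ] Γ
  pairing : Γ →ₗ[A] Γ →ₗ[A] A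
  anchor : Γ →ₗ[A] VF A
  jacobi : ∀ x y z, bracket x (bracket y z) = bracket (bracket x y) z + bracket y (bracket x z)
  pairing_symm : ∀ x y, pairing x y = pairing y x
  pairing_nondegenerate : Function.Bijective pairing
  anchor_pairing_left : ∀ x y z,
    anchor x (pairing y z) = pairing x (bracket y z + bracket z y)
  anchor_pairing : ∀ x y z,
    anchor x (pairing y z) = pairing (bracket x y) z + pairing y (bracket x z)

/-- An extended tangent bundle `𝒯M` (exact Courant algebroid): a Courant algebroid that fits into the
extension `0 → T*M → 𝒯M → TM → 0` of `TM` by `T*M`, whose first map `a*` (here `coanchor`) is the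
dual of the anchor `a` for the pairing `2 ⟨ , ⟩`, i.e. `ξ(a(𝔛)) = 2 ⟨a* ξ, 𝔛⟩`. -/
structure ExtendedTangentBundle (A Γ : Type*) [CommRing A] [Algebra ℝ A] [AddCommGroup Γ]
    [Module ℝ Γ] [Module A Γ] extends CourantAlgebroid A Γ where
  coanchor : Form A 1 →ₗ[A] Γ
  two_mul_pairing_coanchor : ∀ ξ x, 2 * pairing (coanchor ξ) x = ξ ![anchor x]
  coanchor_injective : Function.Injective coanchor
  exact : LinearMap.range coanchor = LinearMap.ker anchor
  anchor_surjective : Function.Surjective anchor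

namespace ExtendedTangentBundle

variable {A Γ : Type*} [CommRing A] [Algebra ℝ A] [AddCommGroup Γ] [Module ℝ Γ] [Module A Γ]
  (T : ExtendedTangentBundle A Γ)

/-- An isotropic splitting `s : TM → 𝒯M`. -/
structure Splitting where
  map : VF A →ₗ[A] Γ
  anchor_map : ∀ X, T.anchor (map X) = X
  isotropic : ∀ X Y, T.pairing (map X) (map Y) = 0

theorem anchor_coanchor (ξ : Form A 1) : T.anchor (T.coanchor ξ) = 0 := by
  have h : T.coanchor ξ ∈ LinearMap.ker T.anchor := T.exact ▸ LinearMap.mem_range_self _ ξ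
  simpa using h

theorem cancel_two {x y : A} (h : 2 * x = 2 * y) : x = y := by
  have h2 : (algebraMap ℝ A (1 / 2)) * 2 = 1 := by
    rw [← map_ofNat (algebraMap ℝ A) 2, ← map_mul]; norm_num
  calc x = (algebraMap ℝ A (1 / 2)) * 2 * x := by rw [h2, one_mul]
    _ = (algebraMap ℝ A (1 / 2)) * 2 * y := by rw [mul_assoc, h, mul_assoc]
    _ = y := by rw [h2, one_mul]

variable {T}

/-- The action `(B ∘ s)(X) = s(X) + ι_X B` of a `2`-form on an isotropic splitting. -/
def Splitting.bTransform (B : Form A 2) (s : T.Splitting) : T.Splitting where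
  map := s.map + T.coanchor ∘ₗ B.curryLeft
  anchor_map X := by simp [s.anchor_map, anchor_coanchor]
  isotropic X Y := by
    apply cancel_two
    have hXY : (B.curryLeft X) ![Y] = - (B.curryLeft Y) ![X] := by
      have := B.map_swap ![Y, X] (show (0 : Fin 2) ≠ 1 by decide)
      have e : (![Y, X] ∘ Equiv.swap (0 : Fin 2) 1) = ![X, Y] := by
        funext i; fin_cases i <;> simp
      rw [e] at this
      simpa using this
    simp only [LinearMap.add_apply, LinearMap.comp_apply, map_add, s.isotropic, mul_add,
      T.two_mul_pairing_coanchor, T.pairing_symm (s.map X) (T.coanchor _), anchor_coanchor,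
      s.anchor_map, hXY]
    have h0 : (B.curryLeft X) ![0] = 0 := (B.curryLeft X).map_coord_zero 0 rfl
    simp [h0]

theorem Splitting.swap_right (s : T.Splitting) (X Y Z : VF A) :
    T.pairing (s.map X) (T.bracket (s.map Y) (s.map Z)) =
      - T.pairing (s.map X) (T.bracket (s.map Z) (s.map Y)) := by
  have h := T.anchor_pairing_left (s.map X) (s.map Y) (s.map Z)
  rw [s.isotropic, map_zero, map_add] at h
  exact eq_neg_of_add_eq_zero_left h.symm

theorem Splitting.swap_outer (s : T.Splitting) (X Y Z : VF A) :
    T.pairing (s.map X) (T.bracket (s.map Y) (s.map Z)) =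
      - T.pairing (s.map Z) (T.bracket (s.map Y) (s.map X)) := by
  have h := T.anchor_pairing (s.map Y) (s.map X) (s.map Z)
  rw [s.isotropic, map_zero, T.pairing_symm (T.bracket _ _)] at h
  exact eq_neg_of_add_eq_zero_right h.symm

theorem Splitting.swap_left (s : T.Splitting) (X Y Z : VF A) :
    T.pairing (s.map X) (T.bracket (s.map Y) (s.map Z)) =
      - T.pairing (s.map Y) (T.bracket (s.map X) (s.map Z)) := by
  rw [s.swap_right, s.swap_outer, s.swap_right, neg_neg]

/-- The closed `3`-form `H(X, Y, Z) = 2 ⟨s(X), s(Y) * s(Z)⟩` determined by an isotropic splitting. -/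
def Splitting.twist (s : T.Splitting) : Form A 3 where
  toFun v := 2 * T.pairing (s.map (v 0)) (T.bracket (s.map (v 1)) (s.map (v 2)))
  map_update_add' := by
    intro inst v i x y
    obtain rfl : inst = instDecidableEqFin 3 := Subsingleton.elim _ _
    fin_cases i <;> simp [mul_add]
  map_update_smul' := by
    intro inst v i c x
    obtain rfl : inst = instDecidableEqFin 3 := Subsingleton.elim _ _
    have h0 : ∀ X Y Z : VF A, T.pairing (s.map (c • X)) (T.bracket (s.map Y) (s.map Z)) =
        c * T.pairing (s.map X) (T.bracket (s.map Y) (s.map Z)) := by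
      intro X Y Z; simp
    have h1 : ∀ X Y Z : VF A, T.pairing (s.map X) (T.bracket (s.map (c • Y)) (s.map Z)) =
        c * T.pairing (s.map X) (T.bracket (s.map Y) (s.map Z)) := by
      intro X Y Z; rw [s.swap_left, h0, s.swap_left X Y, mul_neg]
    have h2 : ∀ X Y Z : VF A, T.pairing (s.map X) (T.bracket (s.map Y) (s.map (c • Z))) =
        c * T.pairing (s.map X) (T.bracket (s.map Y) (s.map Z)) := by
      intro X Y Z; rw [s.swap_outer, h0, s.swap_outer X Y, mul_neg]
    fin_cases i <;>
      simp only [Fin.zero_eta, Fin.mk_one, Fin.reduceFinMk, Function.update_self, ne_eq,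
        Function.update_of_ne, Fin.reduceEq, not_false_eq_true, h0, h1, h2, smul_eq_mul] <;>
      exact mul_left_comm _ _ _
  map_eq_zero_of_eq' := by
    intro v i j hv hij
    have hz : ∀ x : A, x = -x → 2 * x = 0 := fun x h => by linear_combination h
    apply hz
    fin_cases i <;> fin_cases j <;> first
      | exact absurd rfl hij
      | skip
    all_goals simp only [Fin.zero_eta, Fin.mk_one, Fin.reduceFinMk] at hv
    · rw [hv]; exact s.swap_left _ _ _
    · rw [hv]; exact s.swap_outer _ _ _
    · rw [hv]; exact s.swap_left _ _ _
    · rw [hv]; exact s.swap_right _ _ _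
    · rw [hv]; exact s.swap_outer _ _ _
    · rw [hv]; exact s.swap_right _ _ _


/-- The `1`-form `ξ` with `𝔛 = s(X) + ξ`, where `X = a(𝔛)`; explicitly `ξ(Y) = 2 ⟨𝔛, s(Y)⟩`. -/
def Splitting.form (s : T.Splitting) (x : Γ) : Form A 1 :=
  AlternatingMap.ofSubsingleton A (VF A) A (0 : Fin 1) ((2 : A) • (T.pairing x ∘ₗ s.map))

theorem Splitting.map_add_coanchor_form (s : T.Splitting) (x : Γ) :
    s.map (T.anchor x) + T.coanchor (s.form x) = x := by
  have hx : x - s.map (T.anchor x) ∈ LinearMap.ker T.anchor := by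
    simp [s.anchor_map]
  rw [← T.exact] at hx
  obtain ⟨ξ, hξ⟩ := hx
  have : s.form x = ξ := by
    ext v
    have h := T.two_mul_pairing_coanchor ξ (s.map (v 0))
    rw [hξ, s.anchor_map, map_sub, LinearMap.sub_apply, s.isotropic, sub_zero] at h
    have hv : v = ![v 0] := by funext i; fin_cases i; rfl
    rw [hv, ← h]
    simp [Splitting.form]
  rw [this, hξ]; abel

/-! ### Spinors and the Cartan operators -/

variable (T) in
/-- Families of differential forms indexed by the isotropic splittings. -/
abbrev PreSpinor := T.Splitting → Forms A

variable (T) in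
/-- The abstract spinor space `𝒮^•(M) = 𝓘(M) ×_{Ω²(M)} Ω^•(M)`. An element is given by its
representatives `ρ s ∈ Ω^•(M)` in all isotropic splittings `s`; they are related by
`ρ (B ∘ s) = e^B ∧ ρ s`, and each of them determines the spinor because `𝓘(M)` is a torsor over
`Ω²(M)`. -/
def spinors : Submodule ℝ T.PreSpinor where
  carrier := {ρ | ∀ (s : T.Splitting) (B : Form A 2),
    ρ (s.bTransform B) = Forms.expWedge B (ρ s)}
  zero_mem' := by
    intro s B
    funext k
    simp [Forms.expWedge]
  add_mem' := by
    intro ρ σ hρ hσ s B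
    funext k
    simp [hρ s B, hσ s B, Forms.expWedge, Finset.sum_add_distrib]
  smul_mem' := by
    intro c ρ hρ s B
    funext k
    have h : ∀ j, (Forms.wedgeLeft B ^ j) (c • ρ s) = c • (Forms.wedgeLeft B ^ j) (ρ s) :=
      fun j => by
        rw [← algebraMap_smul A c (ρ s), map_smul, algebraMap_smul]
    simp [hρ s B, Forms.expWedge, Finset.smul_sum, h, smul_comm c]

variable (T) in
/-- The differential `d_𝒯` of spinors, given in the splitting `s` by `d_H ρ = dρ - H ∧ ρ`. -/
def dT : T.PreSpinor →ₗ[ℝ] T.PreSpinor :=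
  LinearMap.pi fun s => (Forms.d - (Forms.wedgeLeft s.twist).restrictScalars ℝ) ∘ₗ LinearMap.proj s

variable (T) in
/-- The Clifford action of `𝔛 = s(X) + ξ` on spinors, given in the splitting `s` by
`ι_𝔛 ρ = ι_X ρ + ξ ∧ ρ`. -/
def contract (x : Γ) : T.PreSpinor →ₗ[ℝ] T.PreSpinor :=
  LinearMap.pi fun s => (Forms.contract (T.anchor x) +
    (Forms.wedgeLeft (s.form x)).restrictScalars ℝ) ∘ₗ LinearMap.proj s

variable (T) in
/-- The Lie derivative of spinors along `𝔛 = s(X) + ξ`, given in the splitting `s` by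
`L^𝒯_𝔛 ρ = L_X ρ + (dξ - ι_X H) ∧ ρ`. -/
def lieT (x : Γ) : T.PreSpinor →ₗ[ℝ] T.PreSpinor :=
  LinearMap.pi fun s => (Forms.lie (T.anchor x) +
    (Forms.wedgeLeft (extDeriv (s.form x) - s.twist.curryLeft (T.anchor x))).restrictScalars ℝ) ∘ₗ
      LinearMap.proj s

/-! ### Extended actions -/

/-- The infinitesimal symmetry `κ(𝔛) = (X, dξ - ι_X H) ∈ Γ(TM) ⊕ Ω²(M)` defined by
`𝔛 = s(X) + ξ`, in the splitting `s`. -/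
def Splitting.kappa (s : T.Splitting) (x : Γ) : VF A × Form A 2 :=
  (T.anchor x, extDeriv (s.form x) - s.twist.curryLeft (T.anchor x))

/-- The Lie bracket `[(X, P), (Y, Q)] = ([X, Y], L_X Q - L_Y P)` on the Lie algebra
`Γ(TM) ⊕ Ω²(M)` of infinitesimal symmetries. -/
def symBracket (p q : VF A × Form A 2) : VF A × Form A 2 :=
  (⁅p.1, q.1⁆, lieDeriv p.1 q.2 - lieDeriv q.1 p.2)

section Action

variable {𝔤 : Type*} [LieRing 𝔤] [LieAlgebra ℝ 𝔤]

variable (T) in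
/-- `δ : 𝔤 → Γ(𝒯M)` defines an isotropic extended action: `κ ∘ δ` is a homomorphism of Lie algebras
and the image of `δ` is isotropic. -/
structure IsIsotropicExtendedAction (δ : 𝔤 →ₗ[ℝ] Γ) : Prop where
  kappa_lie : ∀ (s : T.Splitting) (τ υ : 𝔤),
    s.kappa (δ ⁅τ, υ⁆) = symBracket (s.kappa (δ τ)) (s.kappa (δ υ))
  isotropic : ∀ τ υ, T.pairing (δ τ) (δ υ) = 0

variable (T) in
/-- `𝔤`-equivariance of `f : 𝔤 → C^∞(M)`, `τ ↦ f_τ`: one has `f_[τ, υ] = X_τ(f_υ)`, where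
`X_τ = a(δ(τ))` is the vector field by which `τ` acts on `M`. -/
def IsEquivariant (δ : 𝔤 →ₗ[ℝ] Γ) (f : 𝔤 →ₗ[ℝ] A) : Prop :=
  ∀ τ υ, f ⁅τ, υ⁆ = T.anchor (δ τ) (f υ)

variable (T) in
/-- The perturbed map `δ_f(τ) = δ(τ) + df_τ`. -/
def perturb [IsScalarTower ℝ A Γ] (δ : 𝔤 →ₗ[ℝ] Γ) (f : 𝔤 →ₗ[ℝ] A) : 𝔤 →ₗ[ℝ] Γ where
  toFun τ := δ τ + T.coanchor (extDeriv (ofFun (f τ)))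
  map_add' τ υ := by
    rw [map_add, map_add, ofFun_add, extDeriv_add, map_add]
    abel
  map_smul' c τ := by
    rw [map_smul, map_smul, ofFun_smul, extDeriv_const_smul, ← algebraMap_smul A c (extDeriv _),
      map_smul, algebraMap_smul, RingHom.id_apply, smul_add]

end Action

section Series

variable {𝔤 : Type*}

variable (T 𝔤) in
/-- Formal series on `𝔤`, given by the values `ρ p τ` at `τ ∈ 𝔤` of their components of degree
`p`. -/
def Series := ℕ → 𝔤 → T.PreSpinor

instance : AddCommGroup (T.Series 𝔤) := inferInstanceAs (AddCommGroup (ℕ → 𝔤 → T.PreSpinor))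

instance : Module ℝ (T.Series 𝔤) := inferInstanceAs (Module ℝ (ℕ → 𝔤 → T.PreSpinor))

@[simp] theorem Series.zero_apply (p : ℕ) (τ : 𝔤) : (0 : T.Series 𝔤) p τ = 0 := rfl

@[simp] theorem Series.add_apply (ρ σ : T.Series 𝔤) (p : ℕ) (τ : 𝔤) :
    (ρ + σ) p τ = ρ p τ + σ p τ := rfl

@[simp] theorem Series.smul_apply (c : ℝ) (ρ : T.Series 𝔤) (p : ℕ) (τ : 𝔤) :
    (c • ρ) p τ = c • ρ p τ := rfl

end Series

section Cartan

variable {𝔤 : Type*} [LieRing 𝔤] [LieAlgebra ℝ 𝔤]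

variable (T 𝔤) in
/-- The space `𝒮^•(M) ⊗ Ŝ(𝔤*)` of formal power series on `𝔤` with values in `𝒮^•(M)`: the component
of degree `p` is a homogeneous polynomial map of degree `p` from `𝔤` to `𝒮^•(M)`. -/
def spinorSeries : Submodule ℝ (T.Series 𝔤) where
  carrier := {ρ | ∀ p, (∃ μ : MultilinearMap ℝ (fun _ : Fin p => 𝔤) T.PreSpinor,
    ∀ τ, ρ p τ = μ fun _ => τ) ∧ ∀ τ, ρ p τ ∈ T.spinors}
  zero_mem' p := ⟨⟨0, fun _ => rfl⟩, fun _ => zero_mem _⟩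
  add_mem' := by
    intro ρ σ hρ hσ p
    obtain ⟨⟨μ, hμ⟩, h⟩ := hρ p
    obtain ⟨⟨ν, hν⟩, h'⟩ := hσ p
    exact ⟨⟨μ + ν, fun τ => by simp [hμ, hν]⟩, fun τ => add_mem (h τ) (h' τ)⟩
  smul_mem' := by
    intro c ρ hρ p
    obtain ⟨⟨μ, hμ⟩, h⟩ := hρ p
    exact ⟨⟨c • μ, fun τ => by simp [hμ]⟩, fun τ => Submodule.smul_mem _ c (h τ)⟩

variable (T) in
/-- The extended `𝔤`-equivariant Cartan complex: the formal series `ρ` on `𝔤` with values in spinors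
such that `L^𝒯_{δ(τ)} ρ(τ) = 0` for all `τ ∈ 𝔤`. -/
def cartanComplex (δ : 𝔤 →ₗ[ℝ] Γ) : Submodule ℝ (T.Series 𝔤) :=
  T.spinorSeries 𝔤 ⊓
  { carrier := {ρ | ∀ p τ, T.lieT (δ τ) (ρ p τ) = 0}
    zero_mem' := fun p τ => by simp
    add_mem' := fun hρ hσ p τ => by simp [hρ p τ, hσ p τ]
    smul_mem' := fun c ρ hρ p τ => by simp [hρ p τ] }

variable (T) in
/-- The differential `(d_{𝒯,δ} ρ)(τ) = d_𝒯 ρ(τ) - ι_{δ(τ)} ρ(τ)`; the second term raises the degree in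
`τ` by one. -/
def dEq (δ : 𝔤 →ₗ[ℝ] Γ) : T.Series 𝔤 →ₗ[ℝ] T.Series 𝔤 where
  toFun ρ
    | 0 => fun τ => T.dT (ρ 0 τ)
    | p + 1 => fun τ => T.dT (ρ (p + 1) τ) - T.contract (δ τ) (ρ p τ)
  map_add' ρ σ := by
    funext p τ
    cases p with
    | zero => exact map_add T.dT (ρ 0 τ) (σ 0 τ)
    | succ p =>
      change T.dT (ρ (p + 1) τ + σ (p + 1) τ) - T.contract (δ τ) (ρ p τ + σ p τ) =
        (T.dT (ρ (p + 1) τ) - T.contract (δ τ) (ρ p τ)) +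
          (T.dT (σ (p + 1) τ) - T.contract (δ τ) (σ p τ))
      rw [map_add, map_add]
      abel
  map_smul' c ρ := by
    funext p τ
    cases p with
    | zero => exact map_smul T.dT c (ρ 0 τ)
    | succ p =>
      change T.dT (c • ρ (p + 1) τ) - T.contract (δ τ) (c • ρ p τ) =
        c • (T.dT (ρ (p + 1) τ) - T.contract (δ τ) (ρ p τ))
      rw [map_smul, map_smul, smul_sub]

variable (T 𝔤) in
/-- The series of parity `i`: the parity is that of the degree of the differential forms, while `𝔤*`
is even. -/
def parity (i : ZMod 2) : Submodule ℝ (T.Series 𝔤) where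
  carrier := {ρ | ∀ p τ s (k : ℕ), (k : ZMod 2) ≠ i → ρ p τ s k = 0}
  zero_mem' _ _ _ _ _ := rfl
  add_mem' hρ hσ p τ s k hk := by simp [hρ p τ s k hk, hσ p τ s k hk]
  smul_mem' c ρ hρ p τ s k hk := by simp [hρ p τ s k hk]

variable (T) in
/-- The part of parity `i` of the Cartan complex. -/
def cochains (δ : 𝔤 →ₗ[ℝ] Γ) (i : ZMod 2) : Submodule ℝ (T.Series 𝔤) :=
  T.cartanComplex δ ⊓ T.parity 𝔤 i

variable (T) in
/-- The `d_{𝒯,δ}`-closed elements of parity `i`. -/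
def cocycles (δ : 𝔤 →ₗ[ℝ] Γ) (i : ZMod 2) : Submodule ℝ (T.Series 𝔤) :=
  T.cochains δ i ⊓ LinearMap.ker (T.dEq δ)

variable (T) in
/-- The `d_{𝒯,δ}`-exact elements of parity `i`. -/
def coboundaries (δ : 𝔤 →ₗ[ℝ] Γ) (i : ZMod 2) : Submodule ℝ (T.Series 𝔤) :=
  (T.cochains δ (i + 1)).map (T.dEq δ)

variable (T) in
/-- The extended equivariant cohomology `H^i_G(𝒯M; δ)`, `i ∈ ℤ/2`: closed elements modulo exact
ones. -/
abbrev cohomology (δ : 𝔤 →ₗ[ℝ] Γ) (i : ZMod 2) : Type _ :=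
  T.cocycles δ i ⧸ (T.coboundaries δ i).submoduleOf (T.cocycles δ i)

variable (T) in
/-- Multiplication by `e^b = ∑_q b^q / q!`, where `b(τ) ∈ C^∞(M)` is linear in `τ` (in terms of dual
bases `(τⱼ)` of `𝔤` and `(uⱼ)` of `𝔤*`, `b = ∑ⱼ uⱼ b(τⱼ)`):
`(e^b ρ)_p(τ) = ∑_{q ≤ p} (1/q!) b(τ)^q ρ_{p-q}(τ)`. -/
def expMul (b : 𝔤 →ₗ[ℝ] A) : T.Series 𝔤 →ₗ[ℝ] T.Series 𝔤 where
  toFun ρ p τ := ∑ q ∈ Finset.range (p + 1), ((Nat.factorial q : ℝ)⁻¹ • b τ ^ q) • ρ (p - q) τ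
  map_add' ρ σ := by
    funext p τ
    change ∑ q ∈ Finset.range (p + 1), ((Nat.factorial q : ℝ)⁻¹ • b τ ^ q) •
      (ρ (p - q) τ + σ (p - q) τ) = _
    simp only [smul_add, Finset.sum_add_distrib]
    rfl
  map_smul' c ρ := by
    funext p τ
    change ∑ q ∈ Finset.range (p + 1), ((Nat.factorial q : ℝ)⁻¹ • b τ ^ q) •
      (c • ρ (p - q) τ) = c • ∑ q ∈ Finset.range (p + 1),
        ((Nat.factorial q : ℝ)⁻¹ • b τ ^ q) • ρ (p - q) τ
    rw [Finset.smul_sum]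
    exact Finset.sum_congr rfl fun q _ => smul_comm _ _ _

end Cartan

end ExtendedTangentBundle

section Manifold
open Bundle

variable {E : Type*} [NormedAddCommGroup E] [NormedSpace ℝ E] {H : Type*} [TopologicalSpace H]
  {I : ModelWithCorners ℝ E H} {M : Type*} [TopologicalSpace M] [ChartedSpace H M]
  {F : Type*} [NormedAddCommGroup F] [NormedSpace ℝ F] {V : M → Type*}
  [TopologicalSpace (TotalSpace F V)] [∀ x, TopologicalSpace (V x)] [FiberBundle F V]
  [∀ x, AddCommGroup (V x)] [∀ x, Module ℝ (V x)] [VectorBundle ℝ F V]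

/-- The smooth sections of a vector bundle form a module over the smooth functions. -/
instance instModuleSections : Module C^∞⟮I, M; ℝ⟯ Cₛ^∞⟮I; F, V⟯ where
  smul f σ := ⟨fun x => f x • σ x, ContMDiff.smul_section f.contMDiff σ.contMDiff⟩
  one_smul σ := by ext x; exact one_smul ℝ (σ x)
  mul_smul f g σ := by ext x; exact mul_smul (f x) (g x) (σ x)
  smul_zero f := by ext x; exact smul_zero (f x)
  smul_add f σ τ := by ext x; exact smul_add (f x) (σ x) (τ x)
  add_smul f g σ := by ext x; exact add_smul (f x) (g x) (σ x)
  zero_smul σ := by ext x; exact zero_smul ℝ (σ x)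

instance instIsScalarTowerSections : IsScalarTower ℝ C^∞⟮I, M; ℝ⟯ Cₛ^∞⟮I; F, V⟯ :=
  ⟨fun c f σ => by ext x; exact smul_assoc c (f x) (σ x)⟩

end Manifold
end
end ExtendedCartan

/-! In a splitting write `δ(τ) = s(X) + ξ`; the perturbation only replaces `ξ` by `ξ + df_τ`. Since
`d(df_τ) = 0`, `κ` is unchanged (`kappa_perturb`), and since the Lie derivative of spinors depends
only on `κ`, both Cartan complexes have the same invariance condition. Isotropy of `δ_f` reduces to
`X_τ(f_υ) + X_υ(f_τ) = f_[τ,υ] + f_[υ,τ] = 0`.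

Multiplication by `e^b` preserves invariance because the only defect is `X_τ(f_τ) = f_[τ,τ] = 0`.
Its inverse is `e^{-b}`, which goes back from `δ_f` to `δ` by the same argument applied to `-f`;
this gives bijectivity.

For the differentials, `H ∧ ·` and `ι_{δ(τ)}` are linear over functions, so `d_𝒯(e^b ρ) = e^b (d_𝒯 ρ
+ df_τ ∧ ρ)`, while `ι_{δ_f(τ)} = ι_{δ(τ)} + df_τ ∧ ·`. The two terms with `df_τ` cancel
(`dEq_expMul`). In terms of components, `d(b^(q+1)/(q+1)!) = (b^q/q!) db` accounts for the shift by
one in polynomial degree that contraction produces. Thus `e^b` is an isomorphism of complexes, and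
it induces one on cohomology.

The analytic input is the Leibniz rule `extDeriv_mul`, which needs the shuffle definition of the
wedge product made explicit for a `1`-form. -/

namespace ExtendedCartan

/-! ### Exterior multiplication by a `1`-form and the Leibniz rule for functions. -/

section Forms

variable {A : Type*} [CommRing A] [Algebra ℝ A]

/-- The cyclic permutation moving the `i`-th argument to the first place, on `Fin 1 ⊕ Fin k`. -/
def moveFront {k : ℕ} (h : 1 + k = k + 1) (i : Fin (k + 1)) : Equiv.Perm (Fin 1 ⊕ Fin k) :=
  (finSumFinEquiv.trans (finCongr h)).symm.permCongr i.cycleRange.symm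

theorem finSumFinEquiv_finCongr_inl {k : ℕ} (h : 1 + k = k + 1) (a : Fin 1) :
    (finSumFinEquiv.trans (finCongr h)) (Sum.inl a) = 0 := by
  ext; simp

theorem finSumFinEquiv_finCongr_inr {k : ℕ} (h : 1 + k = k + 1) (j : Fin k) :
    (finSumFinEquiv.trans (finCongr h)) (Sum.inr j) = j.succ := by
  ext; simp

theorem apply_moveFront_inl {k : ℕ} (h : 1 + k = k + 1) (i : Fin (k + 1)) (a : Fin 1) :
    (finSumFinEquiv.trans (finCongr h)) (moveFront h i (Sum.inl a)) = i := by
  rw [moveFront, Equiv.permCongr_apply, Equiv.apply_symm_apply, Equiv.symm_symm,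
    finSumFinEquiv_finCongr_inl, Fin.cycleRange_symm_zero]

theorem apply_moveFront_inr {k : ℕ} (h : 1 + k = k + 1) (i : Fin (k + 1)) (j : Fin k) :
    (finSumFinEquiv.trans (finCongr h)) (moveFront h i (Sum.inr j)) = i.succAbove j := by
  rw [moveFront, Equiv.permCongr_apply, Equiv.apply_symm_apply, Equiv.symm_symm,
    finSumFinEquiv_finCongr_inr, Fin.cycleRange_symm_succ]

theorem sign_moveFront {k : ℕ} (h : 1 + k = k + 1) (i : Fin (k + 1)) :
    Equiv.Perm.sign (moveFront h i) = (-1) ^ (i : ℕ) := by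
  rw [moveFront, Equiv.Perm.sign_permCongr, Equiv.Perm.sign_symm, Fin.sign_cycleRange]

/-- The `(1, k)`-shuffles are represented by the permutations `moveFront h i`. -/
theorem bijective_moveFront {k : ℕ} (h : 1 + k = k + 1) :
    Function.Bijective fun i : Fin (k + 1) =>
      (Quotient.mk'' (moveFront h i) : Equiv.Perm.ModSumCongr (Fin 1) (Fin k)) := by
  constructor
  · intro i i' hi
    obtain ⟨⟨sl, sr⟩, hs⟩ := QuotientGroup.leftRel_apply.mp (Quotient.exact' hi)
    -- Permutations in the same coset differ on the right by a block permutation, which keeps the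
    -- one-element left block in place; so both send it to the same index.
    have h1 : moveFront h i' (Sum.inl 0) = moveFront h i (Sum.inl (sl 0)) := by
      have := congrArg (fun σ => moveFront h i * σ) hs
      simp only [mul_inv_cancel_left] at this
      rw [← this]
      simp
    rw [← apply_moveFront_inl h i (sl 0), ← h1, apply_moveFront_inl]
  · intro σ
    induction σ using Quotient.inductionOn' with | _ σ
    -- A coset is determined by where it sends the single left argument: two permutations agreeing
    -- there differ by one that preserves the left block.
    refine ⟨(finSumFinEquiv.trans (finCongr h)) (σ (Sum.inl 0)), ?_⟩
    refine Quotient.sound' (QuotientGroup.leftRel_apply.mpr ?_)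
    apply Equiv.Perm.mem_sumCongrHom_range_of_perm_mapsTo_inl
    rintro _ ⟨a, rfl⟩
    refine ⟨0, ?_⟩
    obtain rfl : a = 0 := Subsingleton.elim _ _
    symm
    rw [Equiv.Perm.mul_apply, Equiv.Perm.inv_eq_iff_eq]
    apply (finSumFinEquiv.trans (finCongr h)).injective
    rw [apply_moveFront_inl]

/-- The exterior product with a `1`-form. -/
theorem wedge_one_apply {k : ℕ} (h : 1 + k = k + 1) (α : Form A 1) (β : Form A k)
    (v : Fin (k + 1) → VF A) :
    wedge h α β v = ∑ i : Fin (k + 1), (-1 : ℤ) ^ (i : ℕ) • (α ![v i] * β (i.removeNth v)) := by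
  simp only [wedge, AlternatingMap.domDomCongr_apply, LinearMap.compAlternatingMap_apply,
    AlternatingMap.domCoprod_apply, sum_apply, map_sum]
  refine (Function.Bijective.sum_comp (bijective_moveFront h) _).symm.trans ?_
  refine Fintype.sum_congr _ _ fun i => ?_
  have hl : (fun a : Fin 1 => v ((finSumFinEquiv.trans (finCongr h))
      (moveFront h i (Sum.inl a)))) = ![v i] := by
    funext a
    rw [apply_moveFront_inl, Matrix.cons_val_fin_one]
  have hr : (fun j : Fin k => v ((finSumFinEquiv.trans (finCongr h))
      (moveFront h i (Sum.inr j)))) = i.removeNth v := by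
    funext j
    rw [apply_moveFront_inr]; rfl
  rw [AlternatingMap.domCoprod.summand_mk'', sign_moveFront, smul_apply,
    MultilinearMap.domDomCongr_apply, MultilinearMap.domCoprod_apply, ← hl, ← hr,
    Units.smul_def, map_zsmul, LinearMap.mul'_apply]
  simp

theorem lieDeriv_mul {k : ℕ} (X : VF A) (g : A) (α : Form A k) :
    lieDeriv X (g • α) = X g • α + g • lieDeriv X α := by
  ext v
  simp only [lieDeriv_apply, AlternatingMap.smul_apply, AlternatingMap.add_apply, smul_eq_mul,
    Derivation.leibniz, ← Finset.mul_sum]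
  ring

theorem extDeriv_ofFun_apply (g : A) (X : VF A) : extDeriv (ofFun g) ![X] = X g :=
  extDeriv_zero_apply g X

/-- The Leibniz rule for the product of a function and a form. -/
theorem extDeriv_mul {k : ℕ} (h : 1 + k = k + 1) (g : A) (α : Form A k) :
    extDeriv (g • α) = wedge h (extDeriv (ofFun g)) α + g • extDeriv α := by
  ext v
  have h2 : ∀ x : A, (1 / 2 : ℝ) • (x + x) = x := fun x => by
    rw [← two_smul ℝ, smul_smul]; norm_num
  -- In the half-sum formula for `d(gα)`, both `v i (gα)` and the Lie derivative contribute `(v i g)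
  -- α`. The wedge term therefore arises twice, and is written here as half its double to match.
  rw [AlternatingMap.add_apply, AlternatingMap.smul_apply, wedge_one_apply,
    ← h2 (∑ i : Fin (k + 1), _), extDeriv_apply, extDeriv_apply, smul_comm g, ← smul_add]
  congr 1
  rw [Finset.smul_sum, ← Finset.sum_add_distrib, ← Finset.sum_add_distrib]
  refine Fintype.sum_congr _ _ fun i => ?_
  rw [lieDeriv_mul, extDeriv_ofFun_apply, smul_comm g, ← smul_add, ← smul_add]
  congr 1
  simp only [AlternatingMap.smul_apply, AlternatingMap.add_apply, smul_eq_mul, Derivation.leibniz]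
  ring

/-- The Koszul formula turns this into `X(Yg) - Y(Xg) - [X,Y]g = 0`, the definition of the
commutator. Only this case of `d² = 0` is needed. -/
theorem extDeriv_extDeriv_ofFun (g : A) : extDeriv (extDeriv (ofFun g)) = 0 := by
  ext v
  have h1 : ∀ w : Fin 1 → VF A, extDeriv (ofFun g) w = w 0 g := fun w => by
    rw [← extDeriv_ofFun_apply]; congr; funext i; fin_cases i; rfl
  rw [extDeriv_apply_koszul]
  simp [Fin.sum_univ_succ, h1, Fin.removeNth, Derivation.commutator_apply]

/-! ### Multiplication by functions and the operators on `Ω^•(M)`. -/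

theorem Forms.d_smul (g : A) (ρ : Forms A) :
    Forms.d (g • ρ) = Forms.wedgeLeft (extDeriv (ofFun g)) ρ + g • Forms.d ρ := by
  funext k
  cases k with
  | zero => simp [Forms.d, Forms.wedgeLeft]
  | succ k => 
    simp only [Forms.d, Forms.wedgeLeft, LinearMap.coe_mk, AddHom.coe_mk, Pi.add_apply,
      Pi.smul_apply, extDeriv_mul (add_comm 1 k)]
    rw [dif_pos (Nat.le_add_left 1 k)]
    rfl

theorem Forms.lie_smul (X : VF A) (g : A) (ρ : Forms A) :
    Forms.lie X (g • ρ) = X g • ρ + g • Forms.lie X ρ :=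
  funext fun k => lieDeriv_mul X g (ρ k)

theorem Forms.contract_smul (X : VF A) (g : A) (ρ : Forms A) :
    Forms.contract X (g • ρ) = g • Forms.contract X ρ := rfl

theorem wedge_add_left {p q k : ℕ} (h : p + q = k) (α α' : Form A p) (β : Form A q) :
    wedge h (α + α') β = wedge h α β + wedge h α' β := by
  simp only [wedge, ← AlternatingMap.domCoprod'_apply, TensorProduct.add_tmul, map_add,
    LinearMap.compAlternatingMap_add, AlternatingMap.domDomCongr_add]

theorem wedge_smul_left {p q k : ℕ} (h : p + q = k) (c : A) (α : Form A p) (β : Form A q) :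
    wedge h (c • α) β = c • wedge h α β := by
  simp only [wedge, ← AlternatingMap.domCoprod'_apply, ← TensorProduct.smul_tmul', map_smul,
    LinearMap.compAlternatingMap_smul, AlternatingMap.domDomCongr_smul]

theorem Forms.wedgeLeft_add {p : ℕ} (α α' : Form A p) (ρ : Forms A) :
    Forms.wedgeLeft (α + α') ρ = Forms.wedgeLeft α ρ + Forms.wedgeLeft α' ρ := by
  funext k
  by_cases h : p ≤ k <;> simp [Forms.wedgeLeft, h, wedge_add_left]

theorem Forms.wedgeLeft_smul {p : ℕ} (c : A) (α : Form A p) (ρ : Forms A) :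
    Forms.wedgeLeft (c • α) ρ = c • Forms.wedgeLeft α ρ := by
  funext k
  by_cases h : p ≤ k <;> simp [Forms.wedgeLeft, h, wedge_smul_left]

theorem Forms.expWedge_smul (B : Form A 2) (g : A) (ρ : Forms A) :
    Forms.expWedge B (g • ρ) = g • Forms.expWedge B ρ := by
  funext k
  simp only [Forms.expWedge, map_smul, Pi.smul_apply, Finset.smul_sum]
  exact Finset.sum_congr rfl fun j _ => smul_comm _ _ _

/-! ### The exponential series of a function, degree by degree. -/

/-- The coefficient `g ^ q / q!` of the exponential series. -/
noncomputable def expCoeff (q : ℕ) (g : A) : A := (Nat.factorial q : ℝ)⁻¹ • g ^ q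

@[simp] theorem expCoeff_zero (g : A) : expCoeff 0 g = 1 := by simp [expCoeff]

/-- The chain rule `X(e^g) = e^g X(g)` in one degree: the factor `q + 1` from the power cancels
against the factorial, so the index drops by one. -/
theorem derivation_expCoeff_succ (X : VF A) (q : ℕ) (g : A) :
    X (expCoeff (q + 1) g) = expCoeff q g * X g := by
  have hq : ((q + 1 : ℕ) : ℝ) ≠ 0 := by positivity
  rw [expCoeff, expCoeff, Derivation.map_smul, Derivation.leibniz_pow, Nat.add_sub_cancel,
    ← Nat.cast_smul_eq_nsmul ℝ, smul_smul, Nat.factorial_succ, Nat.cast_mul, mul_inv, mul_comm,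
    mul_inv_cancel_left₀ hq, smul_eq_mul, smul_mul_assoc]

theorem derivation_expCoeff_eq_zero {X : VF A} {g : A} (h : X g = 0) (q : ℕ) :
    X (expCoeff q g) = 0 := by
  cases q with
  | zero => simp
  | succ q => rw [derivation_expCoeff_succ, h, mul_zero]

theorem extDeriv_expCoeff_succ (q : ℕ) (g : A) :
    extDeriv (ofFun (expCoeff (q + 1) g)) = expCoeff q g • extDeriv (ofFun g) := by
  ext v
  have hv : v = ![v 0] := by funext i; fin_cases i; rfl
  rw [hv, AlternatingMap.smul_apply, extDeriv_ofFun_apply, extDeriv_ofFun_apply,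
    derivation_expCoeff_succ, smul_eq_mul]

/-- The component of degree `n` of `e^g e^g' = e^(g+g')`, which is the binomial theorem divided by
`n!`. -/
theorem sum_expCoeff_mul (n : ℕ) (g g' : A) :
    ∑ x ∈ Finset.HasAntidiagonal.antidiagonal n, expCoeff x.1 g * expCoeff x.2 g' =
      expCoeff n (g + g') := by
  rw [expCoeff, (Commute.all g g').add_pow', Finset.smul_sum]
  refine Finset.sum_congr rfl fun x hx => ?_
  rw [Finset.HasAntidiagonal.mem_antidiagonal] at hx
  subst hx
  rw [expCoeff, expCoeff, smul_mul_smul_comm, ← Nat.cast_smul_eq_nsmul ℝ, smul_smul]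
  congr 1
  rw [Nat.cast_add_choose]
  have h := Nat.cast_ne_zero (R := ℝ).mpr (Nat.factorial_ne_zero (x.1 + x.2))
  field_simp

end Forms

/-! ### Spinor operators and multiplication by functions. -/

namespace ExtendedTangentBundle

variable {A Γ : Type*} [CommRing A] [Algebra ℝ A] [AddCommGroup Γ] [Module ℝ Γ] [Module A Γ]
  {T : ExtendedTangentBundle A Γ}

theorem dT_smul (g : A) (ρ : T.PreSpinor) :
    T.dT (g • ρ) = (fun s => Forms.wedgeLeft (extDeriv (ofFun g)) (ρ s)) + g • T.dT ρ := by
  funext s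
  change Forms.d (g • ρ s) - Forms.wedgeLeft s.twist (g • ρ s) =
    Forms.wedgeLeft (extDeriv (ofFun g)) (ρ s) +
      g • (Forms.d (ρ s) - Forms.wedgeLeft s.twist (ρ s))
  rw [Forms.d_smul, map_smul, smul_sub]
  abel

theorem contract_smul (x : Γ) (g : A) (ρ : T.PreSpinor) :
    T.contract x (g • ρ) = g • T.contract x ρ := by
  funext s
  change Forms.contract (T.anchor x) (g • ρ s) + Forms.wedgeLeft (s.form x) (g • ρ s) =
    g • (Forms.contract (T.anchor x) (ρ s) + Forms.wedgeLeft (s.form x) (ρ s))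
  rw [Forms.contract_smul, map_smul, smul_add]

/-- The wedge part is linear over functions and the Lie derivative is a derivation, so the only
obstruction to commuting is the term `X(g) ρ`. -/
theorem lieT_smul {x : Γ} {g : A} (h : T.anchor x g = 0) (ρ : T.PreSpinor) :
    T.lieT x (g • ρ) = g • T.lieT x ρ := by
  funext s
  change Forms.lie (T.anchor x) (g • ρ s) + Forms.wedgeLeft (s.kappa x).2 (g • ρ s) =
    g • (Forms.lie (T.anchor x) (ρ s) + Forms.wedgeLeft (s.kappa x).2 (ρ s))
  rw [Forms.lie_smul, h, zero_smul, zero_add, map_smul, smul_add]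

theorem lieT_eq_of_kappa_eq {x y : Γ} (h : ∀ s : T.Splitting, s.kappa x = s.kappa y) :
    T.lieT x = T.lieT y := by
  ext1 ρ
  funext s
  change Forms.lie (s.kappa x).1 (ρ s) + Forms.wedgeLeft (s.kappa x).2 (ρ s) =
    Forms.lie (s.kappa y).1 (ρ s) + Forms.wedgeLeft (s.kappa y).2 (ρ s)
  rw [h]

theorem smul_mem_spinors (g : A) {ρ : T.PreSpinor} (hρ : ρ ∈ T.spinors) : g • ρ ∈ T.spinors :=
  fun s B => by
    change g • ρ (s.bTransform B) = _
    rw [hρ s B, ← Forms.expWedge_smul]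
    rfl

theorem pairing_coanchor_coanchor (ξ η : Form A 1) :
    T.pairing (T.coanchor ξ) (T.coanchor η) = 0 := by
  apply cancel_two
  rw [T.two_mul_pairing_coanchor, anchor_coanchor, mul_zero]
  exact ξ.map_coord_zero 0 rfl

/-- The anchor kills the added covector, so both sides share the part `s(X)` of the decomposition;
injectivity of `a*` then identifies the covector parts. -/
theorem Splitting.form_add_coanchor (s : T.Splitting) (x : Γ) (ξ : Form A 1) :
    s.form (x + T.coanchor ξ) = s.form x + ξ := by
  apply T.coanchor_injective
  have h := s.map_add_coanchor_form (x + T.coanchor ξ)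
  rw [map_add, anchor_coanchor, add_zero] at h
  have h' := s.map_add_coanchor_form x
  rw [map_add]
  apply add_left_cancel (a := s.map (T.anchor x))
  rw [h, ← add_assoc, h']

/-! ### The perturbed action `δ_f`. -/

section Perturb

variable [IsScalarTower ℝ A Γ] {𝔤 : Type*} [LieRing 𝔤] [LieAlgebra ℝ 𝔤]

theorem perturb_apply (δ : 𝔤 →ₗ[ℝ] Γ) (f : 𝔤 →ₗ[ℝ] A) (τ : 𝔤) :
    T.perturb δ f τ = δ τ + T.coanchor (extDeriv (ofFun (f τ))) := rfl

theorem anchor_perturb (δ : 𝔤 →ₗ[ℝ] Γ) (f : 𝔤 →ₗ[ℝ] A) (τ : 𝔤) :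
    T.anchor (T.perturb δ f τ) = T.anchor (δ τ) := by
  rw [perturb_apply, map_add, anchor_coanchor, add_zero]

theorem form_perturb (s : T.Splitting) (δ : 𝔤 →ₗ[ℝ] Γ) (f : 𝔤 →ₗ[ℝ] A) (τ : 𝔤) :
    s.form (T.perturb δ f τ) = s.form (δ τ) + extDeriv (ofFun (f τ)) :=
  s.form_add_coanchor _ _

/-- The vector field is unchanged because `a ∘ a* = 0`, the `2`-form because `d(df_τ) = 0`.
Equivariance plays no role. -/
theorem kappa_perturb (s : T.Splitting) (δ : 𝔤 →ₗ[ℝ] Γ) (f : 𝔤 →ₗ[ℝ] A) (τ : 𝔤) :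
    s.kappa (T.perturb δ f τ) = s.kappa (δ τ) := by
  rw [Splitting.kappa, Splitting.kappa, anchor_perturb, form_perturb, extDeriv_add,
    extDeriv_extDeriv_ofFun, add_zero]

theorem contract_perturb (δ : 𝔤 →ₗ[ℝ] Γ) (f : 𝔤 →ₗ[ℝ] A) (τ : 𝔤) (ρ : T.PreSpinor) :
    T.contract (T.perturb δ f τ) ρ =
      T.contract (δ τ) ρ + fun s => Forms.wedgeLeft (extDeriv (ofFun (f τ))) (ρ s) := by
  funext s
  change Forms.contract (T.anchor (T.perturb δ f τ)) (ρ s) +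
      Forms.wedgeLeft (s.form (T.perturb δ f τ)) (ρ s) =
    Forms.contract (T.anchor (δ τ)) (ρ s) + Forms.wedgeLeft (s.form (δ τ)) (ρ s) + _
  rw [anchor_perturb, form_perturb, Forms.wedgeLeft_add, add_assoc]

theorem lieT_perturb (δ : 𝔤 →ₗ[ℝ] Γ) (f : 𝔤 →ₗ[ℝ] A) (τ : 𝔤) :
    T.lieT (T.perturb δ f τ) = T.lieT (δ τ) :=
  lieT_eq_of_kappa_eq fun s => kappa_perturb s δ f τ

theorem IsIsotropicExtendedAction.perturb {δ : 𝔤 →ₗ[ℝ] Γ} (hδ : T.IsIsotropicExtendedAction δ)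
    {f : 𝔤 →ₗ[ℝ] A} (hf : T.IsEquivariant δ f) :
    T.IsIsotropicExtendedAction (T.perturb δ f) where
  kappa_lie s τ υ := by simp only [kappa_perturb, hδ.kappa_lie]
  isotropic τ υ := by
    -- Only the cross terms survive. Doubled, they are `X_υ(f_τ) + X_τ(f_υ) = f_[υ,τ] + f_[τ,υ]`,
    -- which vanishes by antisymmetry of the bracket.
    apply cancel_two
    rw [perturb_apply, perturb_apply, map_add, map_add, LinearMap.add_apply, LinearMap.add_apply,
      hδ.isotropic, pairing_coanchor_coanchor, T.pairing_symm (δ τ), zero_add, add_zero, mul_add,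
      T.two_mul_pairing_coanchor, T.two_mul_pairing_coanchor, extDeriv_ofFun_apply,
      extDeriv_ofFun_apply, ← hf, ← hf, ← lie_skew, map_neg, mul_zero, neg_add_cancel]

theorem perturb_perturb_neg (δ : 𝔤 →ₗ[ℝ] Γ) (f : 𝔤 →ₗ[ℝ] A) :
    T.perturb (T.perturb δ f) (-f) = δ := by
  ext1 τ
  have h : extDeriv (ofFun ((-f) τ)) = -extDeriv (ofFun (f τ)) := by
    rw [LinearMap.neg_apply, ← neg_one_smul ℝ (f τ), ofFun_smul, extDeriv_const_smul]
    ext v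
    simp
  rw [perturb_apply, perturb_apply, h, map_neg, add_neg_cancel_right]

/-- Together with `perturb_perturb_neg`, this makes every statement about passing from `δ` to `δ_f`
by `e^b` also one about returning by `e^{-b}`. -/
theorem IsEquivariant.perturb_neg {δ : 𝔤 →ₗ[ℝ] Γ} {f : 𝔤 →ₗ[ℝ] A} (hf : T.IsEquivariant δ f) :
    T.IsEquivariant (T.perturb δ f) (-f) := fun τ υ => by
  rw [anchor_perturb, LinearMap.neg_apply, LinearMap.neg_apply, map_neg, hf]

omit [IsScalarTower ℝ A Γ] in
theorem IsEquivariant.anchor_self {δ : 𝔤 →ₗ[ℝ] Γ} {f : 𝔤 →ₗ[ℝ] A} (hf : T.IsEquivariant δ f)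
    (τ : 𝔤) : T.anchor (δ τ) (f τ) = 0 := by
  rw [← hf, lie_self, map_zero]

end Perturb

/-! ### The equivariant `B`-transform on series. -/

section ExpMul

variable {𝔤 : Type*} [LieRing 𝔤] [LieAlgebra ℝ 𝔤]

theorem expMul_apply (b : 𝔤 →ₗ[ℝ] A) (ρ : T.Series 𝔤) (p : ℕ) (τ : 𝔤) :
    T.expMul b ρ p τ =
      ∑ x ∈ Finset.HasAntidiagonal.antidiagonal p, expCoeff x.1 (b τ) • ρ x.2 τ := by
  rw [Finset.Nat.sum_antidiagonal_eq_sum_range_succ fun q r => expCoeff q (b τ) • ρ r τ]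
  rfl

theorem expMul_neg_expMul (b : 𝔤 →ₗ[ℝ] A) (ρ : T.Series 𝔤) :
    T.expMul (-b) (T.expMul b ρ) = ρ := by
  funext p τ
  simp only [expMul_apply, Finset.smul_sum, smul_smul]
  -- Associativity of the Cauchy product: regrouping the triple sum over `q + r + t = p` collects
  -- `e^{-b} e^b` into `e^{-b+b}`.
  have hassoc : ∑ x ∈ Finset.HasAntidiagonal.antidiagonal p,
      ∑ y ∈ Finset.HasAntidiagonal.antidiagonal x.2,
        (expCoeff x.1 ((-b) τ) * expCoeff y.1 (b τ)) • ρ y.2 τ =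
      ∑ x ∈ Finset.HasAntidiagonal.antidiagonal p,
        expCoeff x.1 ((-b) τ + b τ) • ρ x.2 τ := by
    simp only [← sum_expCoeff_mul, Finset.sum_smul]
    rw [Finset.sum_sigma', Finset.sum_sigma']
    refine Finset.sum_nbij' (fun x => ⟨(x.1.1 + x.2.1, x.2.2), (x.1.1, x.2.1)⟩)
      (fun x => ⟨(x.2.1, x.2.2 + x.1.2), (x.2.2, x.1.2)⟩) ?_ ?_ ?_ ?_ ?_ <;>
    · simp only [Finset.mem_sigma, Finset.HasAntidiagonal.mem_antidiagonal]
      rintro ⟨⟨a, c⟩, ⟨d, e⟩⟩ ⟨h, h'⟩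
      simp only at h h'
      subst h'
      simp [← h, add_assoc]
  -- The exponent is now `0`, and `0 ^ q = 0` for `q ≠ 0` leaves only the term `(0, p)`.
  rw [hassoc, LinearMap.neg_apply, neg_add_cancel, Finset.sum_eq_single (0, p)]
  · rw [expCoeff_zero, one_smul]
  · rintro ⟨q, r⟩ hx hne
    have hq : q ≠ 0 := by
      rintro rfl
      rw [Finset.HasAntidiagonal.mem_antidiagonal, zero_add] at hx
      exact hne (by rw [← hx])
    rw [expCoeff, zero_pow hq, smul_zero, zero_smul]
  · simp

theorem expMul_expMul_neg (b : 𝔤 →ₗ[ℝ] A) (ρ : T.Series 𝔤) :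
    T.expMul b (T.expMul (-b) ρ) = ρ := by
  have h := expMul_neg_expMul (-b) ρ
  rwa [neg_neg] at h

/-- A homogeneous polynomial map of degree `p` times a linear function. -/
theorem exists_multilinearMap_smul (b : 𝔤 →ₗ[ℝ] A) {p : ℕ}
    (μ : MultilinearMap ℝ (fun _ : Fin p => 𝔤) T.PreSpinor) :
    ∃ ν : MultilinearMap ℝ (fun _ : Fin (p + 1) => 𝔤) T.PreSpinor,
      ∀ τ, (ν fun _ => τ) = b τ • μ fun _ => τ := by
  -- The additional first argument is fed to `b`, the remaining ones to `μ`; on the diagonal this is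
  -- the product.
  refine ⟨LinearMap.uncurryLeft
    { toFun := fun τ => ((LinearMap.lsmul A T.PreSpinor (b τ)).restrictScalars
        ℝ).compMultilinearMap μ
      map_add' := fun τ υ => by ext m; simp
      map_smul' := fun c τ => by ext1 m; simp }, fun τ => rfl⟩

theorem exists_multilinearMap_pow_smul (b : 𝔤 →ₗ[ℝ] A) (q : ℕ) {p : ℕ}
    (μ : MultilinearMap ℝ (fun _ : Fin p => 𝔤) T.PreSpinor) :
    ∃ ν : MultilinearMap ℝ (fun _ : Fin (q + p) => 𝔤) T.PreSpinor,
      ∀ τ, (ν fun _ => τ) = b τ ^ q • μ fun _ => τ := by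
  induction q with
  | zero =>
    rw [zero_add]
    exact ⟨μ, fun τ => by rw [pow_zero, one_smul]⟩
  | succ q ih =>
    obtain ⟨ν, hν⟩ := ih
    obtain ⟨ν', hν'⟩ := exists_multilinearMap_smul b ν
    rw [add_right_comm]
    exact ⟨ν', fun τ => by rw [hν', hν, smul_smul, pow_succ']⟩

theorem expMul_mem_spinorSeries (b : 𝔤 →ₗ[ℝ] A) {ρ : T.Series 𝔤} (hρ : ρ ∈ T.spinorSeries 𝔤) :
    T.expMul b ρ ∈ T.spinorSeries 𝔤 := by
  intro p
  refine ⟨?_, fun τ => ?_⟩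
  · have h : ∀ x : ℕ × ℕ, ∃ ν : MultilinearMap ℝ (fun _ : Fin (x.1 + x.2) => 𝔤) T.PreSpinor,
        ∀ τ, expCoeff x.1 (b τ) • ρ x.2 τ = ν fun _ => τ := fun x => by
      obtain ⟨μ, hμ⟩ := (hρ x.2).1
      obtain ⟨ν, hν⟩ := exists_multilinearMap_pow_smul b x.1 μ
      refine ⟨(Nat.factorial x.1 : ℝ)⁻¹ • ν, fun τ => ?_⟩
      rw [hμ, smul_apply, hν, expCoeff, smul_assoc]
    -- The degree `x.1 + x.2` equals `p` only on the antidiagonal, so the multilinear maps are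
    -- brought to the common type `Fin p` there before they are chosen and summed.
    have h' : ∀ x ∈ Finset.HasAntidiagonal.antidiagonal p,
        ∃ ν : MultilinearMap ℝ (fun _ : Fin p => 𝔤) T.PreSpinor,
          ∀ τ, expCoeff x.1 (b τ) • ρ x.2 τ = ν fun _ => τ := fun x hx => by
      obtain rfl := Finset.HasAntidiagonal.mem_antidiagonal.mp hx
      exact h x
    choose! ν hν using h'
    refine ⟨∑ x ∈ Finset.HasAntidiagonal.antidiagonal p, ν x, fun τ => ?_⟩
    rw [expMul_apply, sum_apply]
    exact Finset.sum_congr rfl fun x hx => hν x hx τ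
  · rw [expMul_apply]
    exact sum_mem fun x _ => smul_mem_spinors _ ((hρ x.2).2 τ)

theorem expMul_mem_parity (b : 𝔤 →ₗ[ℝ] A) {i : ZMod 2} {ρ : T.Series 𝔤} (hρ : ρ ∈ T.parity 𝔤 i) :
    T.expMul b ρ ∈ T.parity 𝔤 i := by
  intro p τ s k hk
  rw [expMul_apply, Finset.sum_apply, Finset.sum_apply]
  refine Finset.sum_eq_zero fun x _ => ?_
  change expCoeff x.1 (b τ) • ρ x.2 τ s k = 0
  rw [hρ _ _ _ _ hk, smul_zero]

variable [IsScalarTower ℝ A Γ] {δ : 𝔤 →ₗ[ℝ] Γ} {f : 𝔤 →ₗ[ℝ] A}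

/-- Invariance is the point: `L^𝒯` is the same for `δ_f(τ)` and `δ(τ)`, and it commutes with each
power of `f_τ` because `X_τ(f_τ) = 0`. -/
theorem expMul_mem_cochains (hf : T.IsEquivariant δ f) {i : ZMod 2} {ρ : T.Series 𝔤}
    (hρ : ρ ∈ T.cochains δ i) : T.expMul f ρ ∈ T.cochains (T.perturb δ f) i := by
  refine ⟨⟨expMul_mem_spinorSeries f hρ.1.1, fun p τ => ?_⟩, expMul_mem_parity f hρ.2⟩
  rw [lieT_perturb, expMul_apply, map_sum]
  refine Finset.sum_eq_zero fun x _ => ?_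
  rw [lieT_smul (derivation_expCoeff_eq_zero (hf.anchor_self τ) _), hρ.1.2 x.2 τ, smul_zero]

theorem expMul_neg_mem_cochains (hf : T.IsEquivariant δ f) {i : ZMod 2} {ρ : T.Series 𝔤}
    (hρ : ρ ∈ T.cochains (T.perturb δ f) i) : T.expMul (-f) ρ ∈ T.cochains δ i := by
  have h := expMul_mem_cochains hf.perturb_neg hρ
  rwa [perturb_perturb_neg] at h

/-- The Leibniz term `df_τ ∧ e^b ρ` from `d_𝒯` cancels the additional covector in `ι_{δ_f(τ)}`. This
is an identity of operators on all series, with neither invariance nor equivariance involved. -/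
theorem dEq_expMul (δ : 𝔤 →ₗ[ℝ] Γ) (f : 𝔤 →ₗ[ℝ] A) (ρ : T.Series 𝔤) :
    T.dEq (T.perturb δ f) (T.expMul f ρ) = T.expMul f (T.dEq δ ρ) := by
  funext p τ
  cases p with
  | zero =>
    change T.dT (T.expMul f ρ 0 τ) = _
    simp only [expMul_apply, Finset.Nat.antidiagonal_zero, Finset.sum_singleton, expCoeff_zero,
      one_smul]
    rfl
  | succ p =>
    change T.dT (T.expMul f ρ (p + 1) τ) - T.contract (T.perturb δ f τ) (T.expMul f ρ p τ) = _
    -- The term with `q = 0` has constant coefficient and yields no `df_τ`. In the others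
    -- `d(f^(q+1)/(q+1)!) = (f^q/q!) df`, and these reassemble into `df_τ` wedge the component of
    -- degree `p`, one lower.
    have hd : T.dT (T.expMul f ρ (p + 1) τ) =
        ∑ x ∈ Finset.HasAntidiagonal.antidiagonal (p + 1), expCoeff x.1 (f τ) • T.dT (ρ x.2 τ) +
          fun s => Forms.wedgeLeft (extDeriv (ofFun (f τ))) (T.expMul f ρ p τ s) := by
      funext s
      rw [expMul_apply, map_sum, Finset.Nat.sum_antidiagonal_succ,
        Finset.Nat.sum_antidiagonal_succ, expMul_apply]
      simp only [dT_smul, extDeriv_expCoeff_succ, Forms.wedgeLeft_smul,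
        Finset.sum_add_distrib, Pi.add_apply, Finset.sum_apply, map_sum, Pi.smul_apply, map_smul,
        expCoeff_zero, one_smul]
      abel
    have hc : T.contract (δ τ) (T.expMul f ρ p τ) =
        ∑ x ∈ Finset.HasAntidiagonal.antidiagonal p,
          expCoeff x.1 (f τ) • T.contract (δ τ) (ρ x.2 τ) := by
      rw [expMul_apply, map_sum]
      exact Finset.sum_congr rfl fun x _ => contract_smul _ _ _
    -- After cancellation the sums are split at the other end, `(p + 1, 0)`: the component of degree
    -- `0` of `d_{𝒯,δ} ρ` has no contraction term, while the component `x.2 + 1` pairs with the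
    -- contraction of `ρ x.2`.
    rw [hd, contract_perturb, hc, add_sub_add_right_eq_sub, expMul_apply,
      Finset.Nat.sum_antidiagonal_succ', Finset.Nat.sum_antidiagonal_succ', add_sub_assoc,
      ← Finset.sum_sub_distrib]
    congr 1
    exact Finset.sum_congr rfl fun x _ => (smul_sub _ _ _).symm

theorem bijOn_expMul (hf : T.IsEquivariant δ f) (i : ZMod 2) :
    Set.BijOn (T.expMul f) (T.cochains δ i) (T.cochains (T.perturb δ f) i) :=
  Set.InvOn.bijOn ⟨fun ρ _ => expMul_neg_expMul f ρ, fun ρ _ => expMul_expMul_neg f ρ⟩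
    (fun _ => expMul_mem_cochains hf) fun _ => expMul_neg_mem_cochains hf

/-! ### Passage to cohomology. -/

variable (T) in
/-- Multiplication by `e^b` as an automorphism of the space of series. -/
noncomputable def expMulEquiv (b : 𝔤 →ₗ[ℝ] A) : T.Series 𝔤 ≃ₗ[ℝ] T.Series 𝔤 :=
  LinearEquiv.ofLinearMap (T.expMul b) (T.expMul (-b)) (LinearMap.ext (expMul_expMul_neg b))
    (LinearMap.ext (expMul_neg_expMul b))

theorem map_expMul_cochains (hf : T.IsEquivariant δ f) (i : ZMod 2) :
    (T.cochains δ i).map (T.expMul f) = T.cochains (T.perturb δ f) i :=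
  SetLike.coe_injective (bijOn_expMul hf i).image_eq

theorem map_expMul_cocycles (hf : T.IsEquivariant δ f) (i : ZMod 2) :
    (T.cocycles δ i).map (T.expMulEquiv f).toLinearMap = T.cocycles (T.perturb δ f) i := by
  rw [cocycles, Submodule.map_inf _ (T.expMulEquiv f).injective]
  refine congrArg₂ _ (map_expMul_cochains hf i) ?_
  ext ρ
  rw [Submodule.mem_map_equiv, LinearMap.mem_ker, LinearMap.mem_ker]
  -- Intertwining expresses the perturbed differential of `ρ` as `e^b` applied to the original
  -- differential of `e^{-b} ρ`; invertibility of `e^b` then identifies the kernels.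
  have h := dEq_expMul δ f (T.expMul (-f) ρ)
  rw [expMul_expMul_neg] at h
  rw [h]
  exact ((T.expMulEquiv f).map_eq_zero_iff).symm

/-- Both sides are images of the same cochains, under `e^b ∘ d_{𝒯,δ}` and under `d_{𝒯,δ_f} ∘ e^b`,
and these composites agree. -/
theorem map_expMul_coboundaries (hf : T.IsEquivariant δ f) (i : ZMod 2) :
    (T.coboundaries δ i).map (T.expMulEquiv f).toLinearMap =
      T.coboundaries (T.perturb δ f) i := by
  rw [coboundaries, coboundaries, ← map_expMul_cochains hf, ← Submodule.map_comp,
    ← Submodule.map_comp]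
  congr 1
  exact LinearMap.ext fun ρ => (dEq_expMul δ f ρ).symm

/-- Multiplication by `e^b` on cocycles. -/
noncomputable def cocyclesEquiv (hf : T.IsEquivariant δ f) (i : ZMod 2) :
    T.cocycles δ i ≃ₗ[ℝ] T.cocycles (T.perturb δ f) i :=
  (T.expMulEquiv f).ofSubmodules _ _ (map_expMul_cocycles hf i)

theorem coe_cocyclesEquiv (hf : T.IsEquivariant δ f) (i : ZMod 2) (z : T.cocycles δ i) :
    (cocyclesEquiv hf i z : T.Series 𝔤) = T.expMul f z := rfl

theorem map_cocyclesEquiv_coboundaries (hf : T.IsEquivariant δ f) (i : ZMod 2) :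
    ((T.coboundaries δ i).submoduleOf (T.cocycles δ i)).map (cocyclesEquiv hf i).toLinearMap =
      (T.coboundaries (T.perturb δ f) i).submoduleOf (T.cocycles (T.perturb δ f) i) := by
  ext w
  obtain ⟨z, rfl⟩ := (cocyclesEquiv hf i).surjective w
  rw [Submodule.mem_map_equiv, LinearEquiv.symm_apply_apply]
  change (z : T.Series 𝔤) ∈ T.coboundaries δ i ↔
    T.expMulEquiv f z ∈ T.coboundaries (T.perturb δ f) i
  rw [← map_expMul_coboundaries hf, Submodule.mem_map_equiv, LinearEquiv.symm_apply_apply]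

/-- The isomorphism `[ρ] ↦ [e^b ρ]` of cohomology. -/
noncomputable def cohomologyEquiv (hf : T.IsEquivariant δ f) (i : ZMod 2) :
    T.cohomology δ i ≃ₗ[ℝ] T.cohomology (T.perturb δ f) i :=
  Submodule.Quotient.equiv _ _ (cocyclesEquiv hf i) (map_cocyclesEquiv_coboundaries hf i)

end ExpMul

end ExtendedTangentBundle

end ExtendedCartan

theorem mainTheorem10 {n : ℕ} {M : Type*} [TopologicalSpace M] [T2Space M]
    [SecondCountableTopology M] [ChartedSpace (EuclideanSpace ℝ (Fin n)) M] [IsManifold (𝓡 n) ∞ M]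
    {F : Type*} [NormedAddCommGroup F] [NormedSpace ℝ F] [FiniteDimensional ℝ F]
    {V : M → Type*} [TopologicalSpace (Bundle.TotalSpace F V)] [∀ x, TopologicalSpace (V x)]
    [∀ x, AddCommGroup (V x)] [∀ x, Module ℝ (V x)] [FiberBundle F V] [VectorBundle ℝ F V]
    [ContMDiffVectorBundle ∞ F V (𝓡 n)]
    (T : ExtendedCartan.ExtendedTangentBundle C^∞⟮𝓡 n, M; ℝ⟯ Cₛ^∞⟮𝓡 n; F, V⟯)
    {𝔤 : Type*} [LieRing 𝔤] [LieAlgebra ℝ 𝔤] [FiniteDimensional ℝ 𝔤]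
    (δ : 𝔤 →ₗ[ℝ] Cₛ^∞⟮𝓡 n; F, V⟯) (hδ : T.IsIsotropicExtendedAction δ)
    (f : 𝔤 →ₗ[ℝ] C^∞⟮𝓡 n, M; ℝ⟯) (hf : T.IsEquivariant δ f) :
    (T.IsIsotropicExtendedAction (T.perturb δ f) ∧
      ∀ (s : T.Splitting) (τ : 𝔤), s.kappa (T.perturb δ f τ) = s.kappa (δ τ)) ∧
    (∀ i : ZMod 2, Set.BijOn (T.expMul f) (T.cochains δ i) (T.cochains (T.perturb δ f) i)) ∧
    (∀ ρ ∈ T.cartanComplex δ,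
      T.dEq (T.perturb δ f) (T.expMul f ρ) = T.expMul f (T.dEq δ ρ)) ∧
    ∀ i : ZMod 2, ∃ Φ : T.cohomology δ i ≃ₗ[ℝ] T.cohomology (T.perturb δ f) i,
      ∀ z : T.cocycles δ i, ∃ w : T.cocycles (T.perturb δ f) i,
        (w : T.Series 𝔤) = T.expMul f z ∧
          Φ (Submodule.Quotient.mk z) = Submodule.Quotient.mk w := by
  refine ⟨⟨hδ.perturb hf, fun s τ => ExtendedCartan.ExtendedTangentBundle.kappa_perturb s δ f τ⟩,
    ExtendedCartan.ExtendedTangentBundle.bijOn_expMul hf,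
    fun ρ _ => ExtendedCartan.ExtendedTangentBundle.dEq_expMul δ f ρ, fun i =>
    ⟨ExtendedCartan.ExtendedTangentBundle.cohomologyEquiv hf i, fun z =>
      ⟨ExtendedCartan.ExtendedTangentBundle.cocyclesEquiv hf i z,
        ExtendedCartan.ExtendedTangentBundle.coe_cocyclesEquiv hf i z, rfl⟩⟩⟩
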